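/- Let $k$ be a field and let $\mathcal D$ be a $k$-linear triangulated category that is Krull--Schmidt, i.e. every object is a finite direct sum of objects with local endomorphism rings. Let $t=(\mathcal D^{t\le 0},\mathcal D^{t\ge 0})$ be a t-structure on $\mathcal D$, with $\mathcal D^{t\le n}=\mathcal D^{t\le 0}[-n]$, $\mathcal D^{t\ge n}=\mathcal D^{t\ge 0}[-n]$, which is non-degenerate, i.e. $\bigcap_n\mathcal D^{t\le n}=\{0\}=\bigcap_n\mathcal D^{t\ge n}$, and whose heart $\heartsuit_t=\mathcal D^{t\le 0}\cap\mathcal D^{t\ge 0}$ is finite-length (every object of $\heartsuit_t$ has finite length). Let $H^0_t\colon\mathcal D\to\heartsuit_t$ be the cohomology functor $t_{\ge 0}t_{\le 0}$. Definitions. - An object $P$ of $\mathcal D$ is *derived projective* if $P\in\mathcal D^{t\le 0}$ and $\operatorname{Hom}(P,X[1])=0$ for all $X\in\mathcal D^{t\le 0}$. - A *derived projective cover* of $X\in\mathcal D$ is a morphism $\pi\colon P\to X$ with $P$ derived projective such that $H^0_t(\pi)$ is a projective cover of $H^0_t(X)$ in $\heartsuit_t$. - $\mathcal D$ *has enough derived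 projectives* with respect to $t$ if $\heartsuit_t$ has enough projectives and every projective object of $\heartsuit_t$ is isomorphic to $H^0_t(\hat P)$ for some derived projective $\hat P$. - For a set $\mathcal S$ of objects let $\mathcal S^{\perp_{>0}}$ (resp. $\mathcal S^{\perp_{<0}}$) be the full subcategory of all $X$ with $\operatorname{Hom}(P,X[m])=0$ for all $P\in\mathcal S$ and all $m>0$ (resp. $m<0$). A *silting collection* is a (not necessarily finite) set $\mathcal S$ of indecomposable, pairwise non-isomorphic objects of $\mathcal D$ such that the full subcategory of direct summands of finite direct sums of objects of $\mathcal S$ is Krull--Schmidt and $t_{\mathcal S}=(\mathcal S^{\perp_{>0}},\mathcal S^{\perp_{<0}})$ is a t-structure. The t-structure $t$ is *silting* if $t=t_{\mathcal S}$ for some silting collection $\mathcal S$. Let $\mathcal L$ be a full set of isomorphism representatives of the simple objects of $\heartsuit_t$ and $\mathcal P$ a full set of isomorphism representatives of the indecomposable derived projective objects. Then the following are equivalent: 1. $t$ is silting. 1'. $\mathcal P$ is a silting collection and $t=t_{\mathcal P}$. 2. There is a bijection $\varphi\colon\mathcal P\to\mathcal L$ such that, for $P\in\mathcal P$, $L\in\mathcal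 L$ and $m\in\mathbb Z$, $\operatorname{Hom}(P,L[m])\cong\operatorname{End}(L)$ as left $\operatorname{End}(L)$-modules if $L=\varphi(P)$ and $m=0$, and $\operatorname{Hom}(P,L[m])=0$ otherwise. 2'. The same as 2, with the isomorphisms $\operatorname{Hom}(P,\varphi(P))\cong\operatorname{End}(\varphi(P))$ only required to be $k$-linear. 3. Every $L\in\mathcal L$ has a derived projective cover. 3'. There is a bijection $\varphi\colon\mathcal P\to\mathcal L$ such that each $P\in\mathcal P$ is (via some morphism $P\to\varphi(P)$) a derived projective cover of $\varphi(P)$. 4. $\mathcal D$ has enough derived projectives with respect to $t$. Moreover, every silting collection $\mathcal S$ with $t=t_{\mathcal S}$ is a full set of isomorphism representatives of the indecomposable derived projective objects (so it agrees with $\mathcal P$ up to isomorphism). -/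

import Mathlib

open CategoryTheory CategoryTheory.Limits CategoryTheory.Pretriangulated CategoryTheory.Triangulated

namespace DerivedProj

universe v u

section General

/-- An additive category is *Krull--Schmidt* if every object is a finite direct sum of objects
whose endomorphism rings are local. -/
def IsKrullSchmidt (A : Type u) [Category.{v} A] [Preadditive A] : Prop :=
  ∀ X : A, ∃ (n : ℕ) (Y : Fin n → A) (b : Bicone Y),
    Nonempty b.IsBilimit ∧ Nonempty (b.pt ≅ X) ∧ ∀ i, IsLocalRing (End (Y i))

/-- Every object has finite length, i.e. is both Noetherian and Artinian. -/
def IsFiniteLengthCategory (A : Type u) [Category.{v} A] : Prop :=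
  ∀ X : A, IsNoetherianObject X ∧ IsArtinianObject X

/-- `π : P ⟶ X` is a *projective cover*: `P` is projective and `π` is an essential epimorphism,
i.e. an epimorphism such that `g` is an epimorphism whenever `g ≫ π` is. -/
def IsProjectiveCover {A : Type u} [Category.{v} A] {P X : A} (π : P ⟶ X) : Prop :=
  Projective P ∧ Epi π ∧ ∀ ⦃Q : A⦄ (g : Q ⟶ P), Epi (g ≫ π) → Epi g

/-- `S` is a full set of isomorphism representatives of the objects satisfying `Q`. -/
def IsFullSetOfIsoReps {A : Type u} [Category.{v} A] (Q : ObjectProperty A) (S : Set A) : Prop :=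
  (∀ X ∈ S, Q X) ∧
  (∀ X ∈ S, ∀ Y ∈ S, Nonempty (X ≅ Y) → X = Y) ∧
  (∀ X : A, Q X → ∃ Y ∈ S, Nonempty (X ≅ Y))

end General

variable {D : Type u} [Category.{v} D] [Preadditive D] [HasZeroObject D] [HasShift D ℤ]
  [∀ n : ℤ, (shiftFunctor D n).Additive] [Pretriangulated D]

section Silting

/-- The full subcategory `S^{⊥_{>0}}`. -/
def perpPos (S : Set D) : ObjectProperty D := fun X =>
  ∀ P ∈ S, ∀ m : ℤ, 0 < m → ∀ f : P ⟶ X⟦m⟧, f = 0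

/-- The full subcategory `S^{⊥_{<0}}`. -/
def perpNeg (S : Set D) : ObjectProperty D := fun X =>
  ∀ P ∈ S, ∀ m : ℤ, m < 0 → ∀ f : P ⟶ X⟦m⟧, f = 0

/-- `Kar(S)`: the direct summands of finite direct sums of objects of `S`. -/
def kar (S : Set D) : ObjectProperty D := fun X =>
  ∃ (n : ℕ) (Y : Fin n → D) (Z : D), (∀ i, Y i ∈ S) ∧ Nonempty (X ⊞ Z ≅ ⨁ Y)

/-- `t` is the t-structure `t_S = (S^{⊥_{>0}}, S^{⊥_{<0}})`. A t-structure is determined by its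
parts `le 0` and `ge 0`. -/
def IsAssociatedTStructure (S : Set D) (t : TStructure D) : Prop :=
  t.le 0 = perpPos S ∧ t.ge 0 = perpNeg S

/-- Silting collections in `D`. -/
structure IsSiltingCollection (S : Set D) : Prop where
  krullSchmidt : IsKrullSchmidt (kar S).FullSubcategory
  indecomposable : ∀ P ∈ S, Indecomposable P
  eq_of_iso : ∀ P ∈ S, ∀ Q ∈ S, Nonempty (P ≅ Q) → P = Q
  exists_tStructure : ∃ t : TStructure D, IsAssociatedTStructure S t

end Silting

section TStructure

variable (t : TStructure D)

/-- A t-structure is *non-degenerate* if the intersection of all `D^{≤ n}` and the intersection of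
all `D^{≥ n}` contain only zero objects. -/
def IsNondegenerate : Prop :=
  (∀ X : D, (∀ n : ℤ, t.le n X) → IsZero X) ∧ (∀ X : D, (∀ n : ℤ, t.ge n X) → IsZero X)

/-- The heart of `t`, as a category. -/
abbrev HeartCat : Type u := t.heart.FullSubcategory

/-- `L` lies in the heart of `t` and is a simple object of the heart. -/
def isSimpleInHeart : ObjectProperty D := fun L =>
  ∃ h : t.heart L, Simple (⟨L, h⟩ : HeartCat t)

/-- Derived projective objects with respect to `t`. -/
def isDerivedProjective : ObjectProperty D := fun P =>
  t.le 0 P ∧ ∀ X : D, t.le 0 X → ∀ f : P ⟶ X⟦(1 : ℤ)⟧, f = 0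

/-- Indecomposable derived projective objects with respect to `t`. -/
def isIndecDerivedProjective : ObjectProperty D := fun P =>
  isDerivedProjective t P ∧ Indecomposable P

variable [IsTriangulated D]

/-- The cohomology functor `H_t^0 = t_{≥ 0} t_{≤ 0}` with values in the heart. -/
noncomputable def H0 : D ⥤ HeartCat t :=
  t.heart.lift (t.truncGELE 0 0) (fun X => (t.mem_heart_iff _).2
    ⟨by dsimp; infer_instance, by dsimp; infer_instance⟩)

/-- `π : P ⟶ X` is a *derived projective cover* of `X` with respect to `t`. -/
def IsDerivedProjectiveCover {P X : D} (π : P ⟶ X) : Prop :=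
  isDerivedProjective t P ∧ IsProjectiveCover ((H0 t).map π)

/-- `D` has derived projectives with respect to `t`. -/
def HasDerivedProjectives : Prop :=
  ∀ P : HeartCat t, Projective P → ∃ Q : D, isDerivedProjective t Q ∧ Nonempty ((H0 t).obj Q ≅ P)

/-- `D` has enough derived projectives with respect to `t`. -/
def HasEnoughDerivedProjectives : Prop :=
  HasDerivedProjectives t ∧ EnoughProjectives (HeartCat t)

end TStructure

end DerivedProj

namespace DerivedProj

/-! A derived projective `P` sees only `H0`: for `Y` in `D^{≤ 0}`, the map `Hom(P, Y) → Hom(H0 P, H0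
Y)` is bijective (`isDerivedProjective.H0_map_injective`, `isDerivedProjective.exists_H0_map_eq`),
and `H0 P` is projective in the heart. Hence projective-cover arguments lift from the heart to `D`.
In particular, if `End P` is local, every nonzero morphism from `P` to a simple object is a derived
projective cover. This turns Hom-relations into covers, and essentiality turns covers into the
bijection and the Hom-relations.

The link with silting is detection. If `t = t_S`, the members of `S` are derived projective, and
non-degeneracy forces some member to map nontrivially to each simple object. Conversely, finite
length builds every projective of the heart from covers of simples, so enough derived projectives
exist. Their indecomposable summands detect nonzero heart objects, and
`DetectsHeart.isAssociatedTStructure` recovers `t` by stripping off one cohomological degree at a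
time. -/

lemma IsProjectiveCover.exists_section {A : Type*} [Category A] {P Q L : A} [Projective Q] {π : P ⟶ L}
    (hπ : IsProjectiveCover π) (σ : Q ⟶ L) [Epi σ] :
    ∃ (s : P ⟶ Q) (r : Q ⟶ P), s ≫ r = 𝟙 P ∧ r ≫ π = σ := by
  have := hπ.1
  have := hπ.2.1
  have h := Projective.factorThru_comp σ π
  set r := Projective.factorThru σ π
  have : Epi r := hπ.2.2 r (by rw [h]; infer_instance)
  exact ⟨Projective.factorThru (𝟙 P) r, r, by simp, h⟩

lemma IsProjectiveCover.comp_iso {A : Type*} [Category A] {P X X' : A} {π : P ⟶ X}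
    (hπ : IsProjectiveCover π) (e : X ≅ X') : IsProjectiveCover (π ≫ e.hom) := by
  obtain ⟨h₁, h₂, h₃⟩ := hπ
  refine ⟨h₁, inferInstance, fun Q g hg ↦ h₃ g ?_⟩
  rw [show g ≫ π = (g ≫ π ≫ e.hom) ≫ e.inv by simp]
  infer_instance

/-! ### Projective covers of simples in finite-length abelian categories -/

section AbelianCategory

variable {A : Type*} [Category A] [Abelian A]

/-- Over a simple object, a nonzero morphism from a projective object with local endomorphism
ring is a projective cover. -/
lemma isProjectiveCover_of_ne_zero {P L : A} [Projective P] [Simple L]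
    (hP : ∀ f : P ⟶ P, IsIso f ∨ IsIso (𝟙 P - f)) {π : P ⟶ L} (hπ : π ≠ 0) :
    IsProjectiveCover π := by
  have : Epi π := epi_of_nonzero_to_simple hπ
  refine ⟨inferInstance, this, fun Q g hg ↦ ?_⟩
  -- Lifting `π` through `g ≫ π` gives `s` with `(𝟙 P - s ≫ g) ≫ π = 0`, so `𝟙 P - s ≫ g` cannot be
  -- invertible.
  have h := Projective.factorThru_comp π (g ≫ π)
  set s := Projective.factorThru π (g ≫ π)
  rcases hP (s ≫ g) with h₁ | h₁
  · exact epi_of_epi s g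
  · refine (hπ ?_).elim
    rw [← cancel_epi (𝟙 P - s ≫ g)]
    simp [h]

/-- Were `π` nonzero on `ker σ`, essentiality would make `ker σ ⟶ P` epi and kill `σ`. So `π`
descends along `σ` to a nonzero map of simples. -/
lemma IsProjectiveCover.exists_iso_of_ne_zero {P L L' : A} [Simple L] [Simple L'] {π : P ⟶ L}
    (hπ : IsProjectiveCover π) {σ : P ⟶ L'} (hσ : σ ≠ 0) : ∃ e : L ≅ L', π ≫ e.hom = σ := by
  have := hπ.2.1
  have : Epi σ := epi_of_nonzero_to_simple hσ
  have h : kernel.ι σ ≫ π = 0 := by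
    by_contra h
    have : Epi (kernel.ι σ) := hπ.2.2 _ (epi_of_nonzero_to_simple h)
    exact hσ (by rw [← cancel_epi (kernel.ι σ), kernel.condition, comp_zero])
  have hd := Abelian.comp_epiDesc σ π h
  set d := Abelian.epiDesc σ π h
  have : IsIso d := isIso_of_hom_simple (fun h0 ↦ by
    have : π = 0 := by rw [← hd, h0, comp_zero]
    subst this
    exact Simple.not_isZero L (IsZero.of_epi_eq_zero (0 : P ⟶ L) rfl))
  exact ⟨(asIso d).symm, by simp [← hd]⟩

/-- A nonzero Noetherian object has a simple quotient. -/
lemma exists_epi_to_simple {X : A} [IsNoetherianObject X] (hX : ¬ IsZero X) :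
    ∃ (L : A) (_ : Simple L) (σ : X ⟶ L), Epi σ := by
  have : Nontrivial (Subobject X) := Subobject.nontrivial_of_not_isZero hX
  obtain ⟨Y, hY, -⟩ := (IsCoatomic.eq_top_or_exists_le_coatom (⊥ : Subobject X)).resolve_left
    bot_ne_top
  refine ⟨cokernel Y.arrow, simple_of_cosimple _ fun {Z} f _ ↦ ⟨?_, fun hf ↦ ?_⟩,
    cokernel.π Y.arrow, inferInstance⟩
  · rintro hf rfl
    have hz : IsZero (cokernel Y.arrow) := by
      rw [IsZero.iff_id_eq_zero, ← cancel_mono (0 : cokernel Y.arrow ⟶ Z)]; simp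
    have : Epi Y.arrow := Preadditive.epi_of_cokernel_zero (hz.eq_of_tgt _ _)
    have : IsIso Y.arrow := isIso_of_mono_of_epi _
    exact hY.1 (Subobject.eq_top_of_isIso_arrow Y)
  -- This kernel contains the maximal subobject `Y`, so it is `Y` or everything; the latter would
  -- give `f = 0`.
  · have hle : Y ≤ kernelSubobject (cokernel.π Y.arrow ≫ f) :=
      le_kernelSubobject _ _ (by simp)
    have heq : kernelSubobject (cokernel.π Y.arrow ≫ f) = Y := by
      rcases hle.lt_or_eq with h | h
      · refine (hf ?_).elim
        have := hY.2 _ h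
        have h0 := kernelSubobject_arrow_comp (cokernel.π Y.arrow ≫ f)
        have : IsIso (kernelSubobject (cokernel.π Y.arrow ≫ f)).arrow :=
          (Subobject.isIso_arrow_iff_eq_top _).2 this
        rw [← cancel_epi (cokernel.π Y.arrow), comp_zero,
          ← cancel_epi (kernelSubobject (cokernel.π Y.arrow ≫ f)).arrow, h0, comp_zero]
      · exact h.symm
    have : Mono f := by
      refine Preadditive.mono_of_cancel_zero _ fun {G} g hg ↦ ?_
      obtain ⟨B, p, _, x, hx⟩ := surjective_up_to_refinements_of_epi (cokernel.π Y.arrow) g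
      have hfac : (kernelSubobject (cokernel.π Y.arrow ≫ f)).Factors x :=
        kernelSubobject_factors _ _ (by rw [← Category.assoc, ← hx, Category.assoc, hg, comp_zero])
      rw [heq] at hfac
      rw [← cancel_epi p, hx, ← Subobject.factorThru_arrow _ _ hfac, Category.assoc,
        cokernel.condition, comp_zero, comp_zero]
    exact isIso_of_mono_of_epi f

/-- In a finite-length category, a class of projective objects which is closed under binary
biproducts and covers all simple objects covers all objects. -/
lemma exists_epi_of_forall_simple (hA : IsFiniteLengthCategory A) (C : ObjectProperty A)
    (hzero : ∃ Z, IsZero Z ∧ C Z) (hbiprod : ∀ X Y, C X → C Y → C (X ⊞ Y))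
    (hproj : ∀ X, C X → Projective X)
    (hsimple : ∀ (L : A) [Simple L], ∃ (X : A) (π : X ⟶ L), C X ∧ Epi π) (X : A) :
    ∃ (P : A) (π : P ⟶ X), C P ∧ Epi π := by
  have := (hA X).1
  obtain ⟨Z, hZ, hCZ⟩ := hzero
  -- Choose a maximal image of an object of `C`. If it is proper, lifting a cover of a simple
  -- subobject of the cokernel enlarges it.
  obtain ⟨M, ⟨P, f, hP, rfl⟩, hmax⟩ := wellFounded_gt.has_min
    {Y : Subobject X | ∃ (P : A) (f : P ⟶ X), C P ∧ imageSubobject f = Y}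
    ⟨_, Z, 0, hCZ, rfl⟩
  refine ⟨P, f, hP, ?_⟩
  by_contra hf
  have := (hA (cokernel f)).2
  have hc : ¬ IsZero (cokernel f) := fun h ↦ hf
    (Preadditive.epi_of_cokernel_zero (h.eq_of_tgt _ _))
  obtain ⟨Q, π, hQ, _⟩ := hsimple (simpleSubobject hc)
  have := hproj Q hQ
  have hg := Projective.factorThru_comp (π ≫ simpleSubobjectArrow hc) (cokernel.π f)
  set g := Projective.factorThru (π ≫ simpleSubobjectArrow hc) (cokernel.π f)
  have hle : imageSubobject f ≤ imageSubobject (biprod.desc f g) := by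
    simpa using imageSubobject_comp_le biprod.inl (biprod.desc f g)
  have hle' : imageSubobject g ≤ imageSubobject (biprod.desc f g) := by
    simpa using imageSubobject_comp_le biprod.inr (biprod.desc f g)
  have heq : imageSubobject f = imageSubobject (biprod.desc f g) := by
    by_contra hne
    exact hmax _ ⟨_, _, hbiprod _ _ hP hQ, rfl⟩ (lt_of_le_of_ne hle hne)
  rw [← heq] at hle'
  have h0 : (imageSubobject f).arrow ≫ cokernel.π f = 0 := by
    rw [← cancel_epi (factorThruImageSubobject f)]; simp
  have h1 : g ≫ cokernel.π f = 0 := by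
    rw [← imageSubobject_arrow_comp g, ← Subobject.ofLE_arrow hle', Category.assoc,
      Category.assoc, h0, comp_zero, comp_zero]
  rw [h1] at hg
  have h2 : simpleSubobjectArrow hc = 0 := by
    rw [← cancel_epi π, ← hg, comp_zero]
  exact Simple.not_isZero (simpleSubobject hc) (IsZero.of_mono_eq_zero _ h2)

/-- In a finite-length category, a class of objects which is closed under isomorphisms and binary
biproducts and contains projective covers of all simple objects contains all projective
objects. -/
lemma of_projective_of_forall_simple (hA : IsFiniteLengthCategory A) (C : ObjectProperty A)
    [C.IsClosedUnderIsomorphisms]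
    (hzero : ∃ Z, IsZero Z ∧ C Z) (hbiprod : ∀ X Y, C X → C Y → C (X ⊞ Y))
    (hsimple : ∀ (L : A) [Simple L], ∃ (X : A) (π : X ⟶ L), C X ∧ IsProjectiveCover π)
    (Q : A) [Projective Q] : C Q := by
  have := (hA Q).1
  obtain ⟨Z, hZ, hCZ⟩ := hzero
  -- Choose a maximal split subobject of `Q` lying in `C`. A nonzero complement `kernel r` has a
  -- simple quotient, whose projective cover splits off and enlarges it.
  obtain ⟨M, ⟨Y, i, _, hY, ⟨r, hr⟩, rfl⟩, hmax⟩ := wellFounded_gt.has_min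
    {M : Subobject Q | ∃ (Y : A) (i : Y ⟶ Q) (_ : Mono i), C Y ∧ (∃ r, i ≫ r = 𝟙 Y) ∧
      Subobject.mk i = M}
    ⟨_, Z, 0, ⟨fun _ _ _ ↦ hZ.eq_of_tgt _ _⟩, hCZ, ⟨0, hZ.eq_of_tgt _ _⟩, rfl⟩
  by_cases hK : IsZero (kernel r)
  · have : Mono r := Preadditive.mono_of_kernel_zero (hK.eq_of_src _ _)
    exact C.prop_of_iso (⟨i, r, hr, by rw [← cancel_mono r]; simp [hr]⟩ : Y ≅ Q) hY
  · exfalso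
    let q : Q ⟶ kernel r := kernel.lift r (𝟙 Q - r ≫ i) (by simp [hr])
    have hq : kernel.ι r ≫ q = 𝟙 _ := by
      rw [← cancel_mono (kernel.ι r)]; simp [q]
    have hiq : i ≫ q = 0 := by
      rw [← cancel_mono (kernel.ι r)]; simp [q, reassoc_of% hr]
    have : Projective (kernel r) := Retract.projective ⟨kernel.ι r, q, hq⟩
    have := (hA (kernel r)).1
    obtain ⟨L, _, σ, _⟩ := exists_epi_to_simple hK
    obtain ⟨P, π, hP, hπ⟩ := hsimple L
    obtain ⟨s, p, hsp, -⟩ := hπ.exists_section σ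
    let j : Y ⊞ P ⟶ Q := biprod.desc i (s ≫ kernel.ι r)
    have hj : j ≫ biprod.lift r (q ≫ p) = 𝟙 _ := by
      ext <;> simp [j, hr, reassoc_of% hiq, reassoc_of% hq, hsp]
    have : Mono j := mono_of_mono_fac hj
    have hle : Subobject.mk i ≤ Subobject.mk j := Subobject.mk_le_mk_of_comm biprod.inl (by simp [j])
    have heq : Subobject.mk i = Subobject.mk j := by
      by_contra hne
      exact hmax _ ⟨_, j, this, hbiprod _ _ hY hP, ⟨_, hj⟩, rfl⟩ (lt_of_le_of_ne hle hne)
    have h1 : (biprod.inr ≫ Subobject.ofMkLEMk j i heq.ge) ≫ i = s ≫ kernel.ι r := by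
      simp [j]
    have h2 : s = 0 := by
      have := congr_arg (· ≫ q) h1
      simp only [Category.assoc, hiq, comp_zero, hq, Category.comp_id] at this
      exact this.symm
    have h3 : IsZero P := by rw [IsZero.iff_id_eq_zero, ← hsp, h2, zero_comp]
    have := hπ.2.1
    exact Simple.not_isZero L (IsZero.of_epi_eq_zero π (h3.eq_of_src _ _))

end AbelianCategory

/-! ### Local endomorphism rings and indecomposability -/

section LocalEndomorphismRing

variable {C : Type*} [Category C] [Preadditive C]

lemma isLocalRing_end_iff {X : C} :
    IsLocalRing (End X) ↔ ¬ IsZero X ∧ ∀ f : X ⟶ X, IsIso f ∨ IsIso (𝟙 X - f) := by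
  refine ⟨fun h ↦ ⟨fun hX ↦ ?_, fun f ↦ ?_⟩, fun ⟨hX, h⟩ ↦ ?_⟩
  · obtain ⟨_, _, hne⟩ := h.toNontrivial.exists_pair_ne
    exact hne (hX.eq_of_src _ _)
  · rw [← isUnit_iff_isIso, ← isUnit_iff_isIso]
    exact h.isUnit_or_isUnit_of_add_one (add_sub_cancel (f : X ⟶ X) (𝟙 X))
  · have : Nontrivial (End X) := ⟨1, 0, fun h ↦ hX ((IsZero.iff_id_eq_zero X).2 h)⟩
    refine ⟨fun {a b} hab ↦ ?_⟩
    rw [isUnit_iff_isIso, isUnit_iff_isIso, eq_sub_of_add_eq' hab]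
    exact h a

/-- A nonzero retract of an object with local endomorphism ring is isomorphic to it. -/
lemma comp_eq_id_of_isLocalRing {X Y : C} (h : IsLocalRing (End X)) {i : Y ⟶ X} {r : X ⟶ Y}
    (hir : i ≫ r = 𝟙 Y) (hY : ¬ IsZero Y) : r ≫ i = 𝟙 X := by
  rcases (isLocalRing_end_iff.1 h).2 (r ≫ i) with h₁ | h₁
  · rw [← cancel_epi (r ≫ i)]
    simp [reassoc_of% hir]
  · refine (hY ?_).elim
    have : i = 0 := by
      rw [← cancel_mono (𝟙 X - r ≫ i)]
      simp [reassoc_of% hir]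
    rw [IsZero.iff_id_eq_zero, ← hir, this, zero_comp]

lemma indecomposable_of_isLocalRing [HasBinaryBiproducts C] {X : C} (h : IsLocalRing (End X)) :
    Indecomposable X := by
  refine ⟨(isLocalRing_end_iff.1 h).1, fun Y Z e ↦ or_iff_not_imp_left.2 fun hY ↦ ?_⟩
  have := comp_eq_id_of_isLocalRing h (i := biprod.inl ≫ e.inv) (r := e.hom ≫ biprod.fst)
    (by simp) hY
  have h0 : (biprod.inr : Z ⟶ Y ⊞ Z) ≫ e.inv = 0 := by
    rw [← Category.comp_id (biprod.inr ≫ e.inv), ← this]; simp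
  rw [IsZero.iff_id_eq_zero, ← biprod.inr_snd (X := Y), ← Category.id_comp biprod.snd, ← e.inv_hom_id,
    Category.assoc, ← Category.assoc, h0, zero_comp]

lemma isLocalRing_end_of_iso {X Y : C} (e : X ≅ Y) (h : IsLocalRing (End X)) :
    IsLocalRing (End Y) := by
  rw [isLocalRing_end_iff] at h ⊢
  refine ⟨fun hY ↦ h.1 (hY.of_iso e), fun f ↦ ?_⟩
  rcases h.2 (e.hom ≫ f ≫ e.inv) with _ | _
  · left
    rw [show f = e.inv ≫ (e.hom ≫ f ≫ e.inv) ≫ e.hom by simp]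
    infer_instance
  · right
    rw [show 𝟙 Y - f = e.inv ≫ (𝟙 X - e.hom ≫ f ≫ e.inv) ≫ e.hom by simp]
    infer_instance

end LocalEndomorphismRing

section Triangulated

variable {D : Type*} [Category D] [Preadditive D] [HasZeroObject D] [HasShift D ℤ]
  [∀ n : ℤ, (shiftFunctor D n).Additive] [Pretriangulated D]

/-- The cone of a split monomorphism has zero connecting morphism, so its triangle splits and the
cone is the complement. -/
lemma exists_iso_biprod_of_retract {X Y : D} {i : Y ⟶ X} {r : X ⟶ Y} (hir : i ≫ r = 𝟙 Y) :
    ∃ Z, Nonempty (X ≅ Y ⊞ Z) := by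
  obtain ⟨Z, g, h, hT⟩ := distinguished_cocone_triangle i
  have : Mono i := mono_of_mono_fac hir
  obtain ⟨e, -⟩ := exists_iso_binaryBiproduct_of_distTriang _ hT
    ((Triangle.mor₃_eq_zero_iff_mono₁ _ hT).2 this)
  exact ⟨Z, ⟨e⟩⟩

lemma iso_of_indecomposable_of_retract {X Y : D} (hX : Indecomposable X) {i : Y ⟶ X} {r : X ⟶ Y}
    (hir : i ≫ r = 𝟙 Y) (hY : ¬ IsZero Y) : Nonempty (Y ≅ X) := by
  obtain ⟨Z, ⟨e⟩⟩ := exists_iso_biprod_of_retract hir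
  have hZ := (hX.2 Y Z e).resolve_left hY
  exact ⟨(e ≪≫ ⟨biprod.fst, biprod.inl, by ext <;> simp [hZ.eq_of_src biprod.inr 0], by simp⟩).symm⟩

lemma IsKrullSchmidt.isLocalRing_end (hD : IsKrullSchmidt D) {X : D} (hX : Indecomposable X) :
    IsLocalRing (End X) := by
  obtain ⟨n, Y, b, ⟨hb⟩, ⟨e⟩, hY⟩ := hD X
  cases n with
  | zero =>
    exfalso
    refine hX.1 (IsZero.of_iso ?_ e.symm)
    rw [IsZero.iff_id_eq_zero, ← IsBilimit.total hb]
    simp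
  | succ n =>
    obtain ⟨e'⟩ := iso_of_indecomposable_of_retract hX (i := b.ι 0 ≫ e.hom) (r := e.inv ≫ b.π 0)
      (by simp) ((isLocalRing_end_iff.1 (hY 0)).1)
    exact isLocalRing_end_of_iso e' (hY 0)

end Triangulated

section

variable {D : Type*} [Category D] [Preadditive D] [HasZeroObject D] [HasShift D ℤ]
  [∀ n : ℤ, (shiftFunctor D n).Additive] [Pretriangulated D] (t : TStructure D)

/-- Shifting by `-1` and then by `1`. -/
noncomputable def shiftNegOneShiftOne (X : D) : (X⟦(-1 : ℤ)⟧)⟦(1 : ℤ)⟧ ≅ X :=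
  (shiftFunctorCompIsoId D (-1 : ℤ) 1 (by simp)).app X

lemma distinguished_of_iso_obj₁ {X X' Y Z : D} (e : X' ≅ X) {f : X ⟶ Y} {g : Y ⟶ Z}
    {h : Z ⟶ X⟦(1 : ℤ)⟧} (hT : Triangle.mk f g h ∈ distTriang D) :
    Triangle.mk (e.hom ≫ f) g (h ≫ e.inv⟦(1 : ℤ)⟧') ∈ distTriang D := by
  have h₃ : (h ≫ e.inv⟦(1 : ℤ)⟧') ≫ e.hom⟦(1 : ℤ)⟧' = h := by
    rw [Category.assoc, ← Functor.map_comp, e.inv_hom_id, CategoryTheory.Functor.map_id, Category.comp_id]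
  exact isomorphic_distinguished _ hT _ (Triangle.isoMk _ _ e (Iso.refl _) (Iso.refl _)
    (Category.comp_id (e.hom ≫ f)) ((Category.comp_id g).trans (Category.id_comp g).symm)
    (h₃.trans (Category.id_comp h).symm))

/-! ### The heart is abelian -/

section HeartAbelian

lemma isLE_biprod (n : ℤ) (X Y : D) [hX : t.IsLE X n] [hY : t.IsLE Y n] : t.IsLE (X ⊞ Y) n :=
  t.isLE₂ _ (binaryBiproductTriangle_distinguished X Y) n hX hY

lemma isGE_biprod (n : ℤ) (X Y : D) [hX : t.IsGE X n] [hY : t.IsGE Y n] : t.IsGE (X ⊞ Y) n :=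
  t.isGE₂ _ (binaryBiproductTriangle_distinguished X Y) n hX hY

instance (X : HeartCat t) : t.IsLE X.obj 0 := ((t.mem_heart_iff _).1 X.property).1

instance (X : HeartCat t) : t.IsGE X.obj 0 := ((t.mem_heart_iff _).1 X.property).2

lemma isZero_heart_iff (X : HeartCat t) : IsZero X ↔ IsZero X.obj := by
  rw [IsZero.iff_id_eq_zero, IsZero.iff_id_eq_zero]
  exact ⟨fun h ↦ congr_arg (fun f ↦ f.hom) h, fun h ↦ ObjectProperty.hom_ext _ h⟩

instance : HasZeroObject (HeartCat t) :=
  ⟨⟨_, (t.mem_heart_iff _).2 ⟨t.isLE_of_isZero (isZero_zero D) 0, t.isGE_of_isZero (isZero_zero D) 0⟩⟩,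
    (isZero_heart_iff t _).2 (isZero_zero D)⟩

instance : HasBinaryBiproducts (HeartCat t) where
  has_binary_biproduct X Y := by
    let Z : HeartCat t := ⟨X.obj ⊞ Y.obj, (t.mem_heart_iff _).2
      ⟨isLE_biprod t 0 _ _, isGE_biprod t 0 _ _⟩⟩
    exact hasBinaryBiproduct_of_total
      { pt := Z
        fst := ObjectProperty.homMk (biprod.fst : X.obj ⊞ Y.obj ⟶ _)
        snd := ObjectProperty.homMk (biprod.snd : X.obj ⊞ Y.obj ⟶ _)
        inl := ObjectProperty.homMk (biprod.inl : _ ⟶ X.obj ⊞ Y.obj)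
        inr := ObjectProperty.homMk (biprod.inr : _ ⟶ X.obj ⊞ Y.obj)
        inl_fst := ObjectProperty.hom_ext _ biprod.inl_fst
        inl_snd := ObjectProperty.hom_ext _ biprod.inl_snd
        inr_fst := ObjectProperty.hom_ext _ biprod.inr_fst
        inr_snd := ObjectProperty.hom_ext _ biprod.inr_snd }
      (ObjectProperty.hom_ext _ biprod.total)

instance : HasFiniteProducts (HeartCat t) := hasFiniteProducts_of_has_binary_and_terminal

lemma heart_hom_shift_eq_zero ⦃X Y : HeartCat t⦄ ⦃n : ℤ⦄
    (f : t.heart.ι.obj X ⟶ (t.heart.ι.obj Y)⟦n⟧) (hn : n < 0) : f = 0 := by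
  have := t.isGE_shift Y.obj 0 n (-n)
  exact t.zero (X := X.obj) (Y := Y.obj⟦n⟧) f 0 (-n)

variable [IsTriangulated D]

/-- The cone of a morphism of the heart lies in degrees `[-1, 0]`; its truncation triangle supplies
the kernel, shifted by `1`, and the cokernel. -/
lemma admissibleMorphism_heart : AbelianSubcategory.admissibleMorphism t.heart.ι = ⊤ := by
  rw [eq_top_iff]
  intro X₁ X₂ f₁ _ X₃ f₂ f₃ hT
  have h₁ := t.isLE_shift X₁.obj 0 1 (-1)
  have h₁' := t.isGE_shift X₁.obj 0 1 (-1)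
  have hLE : t.IsLE X₃ 0 := t.isLE₂ _ (rot_of_distTriang _ hT) 0 (inferInstanceAs (t.IsLE X₂.obj 0))
    (t.isLE_of_le (X₁.obj⟦(1 : ℤ)⟧) (-1) 0)
  have hGE : t.IsGE X₃ (-1) := t.isGE₂ _ (rot_of_distTriang _ hT) (-1)
    (t.isGE_of_ge X₂.obj (-1) 0) h₁'
  have := t.isLE_truncLT_obj X₃ 0 (-1)
  exact ⟨⟨((t.truncLT 0).obj X₃)⟦(-1 : ℤ)⟧, (t.mem_heart_iff _).2
    ⟨t.isLE_shift _ (-1) (-1) 0, t.isGE_shift _ (-1) (-1) 0⟩⟩,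
    ⟨(t.truncGE 0).obj X₃, (t.mem_heart_iff _).2 ⟨inferInstance, inferInstance⟩⟩, _, _, _,
    distinguished_of_iso_obj₁ (shiftNegOneShiftOne ((t.truncLT 0).obj X₃))
      (t.triangleLTGE_distinguished 0 X₃)⟩

noncomputable instance abelianHeart : Abelian (HeartCat t) :=
  AbelianSubcategory.abelian t.heart.ι (heart_hom_shift_eq_zero t) (admissibleMorphism_heart t)

end HeartAbelian

end

section

variable {D : Type*} [Category D] [Preadditive D] [HasZeroObject D] [HasShift D ℤ]
  [∀ n : ℤ, (shiftFunctor D n).Additive] [Pretriangulated D] (t : TStructure D)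

lemma distinguished_of_iso_obj₂ {X Y Y' Z : D} (e : Y ≅ Y') {f : X ⟶ Y} {g : Y ⟶ Z}
    {h : Z ⟶ X⟦(1 : ℤ)⟧} (hT : Triangle.mk f g h ∈ distTriang D) :
    Triangle.mk (f ≫ e.hom) (e.inv ≫ g) h ∈ distTriang D := by
  have h₁ : (f ≫ e.hom) ≫ e.inv = f := by simp
  exact isomorphic_distinguished _ hT _ (Triangle.isoMk _ _ (Iso.refl _) e.symm (Iso.refl _)
    (h₁.trans (Category.id_comp f).symm) (Category.comp_id (e.inv ≫ g))
    ((congr_arg (h ≫ ·) (CategoryTheory.Functor.map_id _ _)).trans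
      ((Category.comp_id h).trans (Category.id_comp h).symm)))

/-! ### Vanishing and closure properties of derived projectives -/

section DerivedProjective

variable {t} {P : D} (hP : isDerivedProjective t P)
include hP

lemma isDerivedProjective.eq_zero_of_isLE {X : D} (hX : t.IsLE X (-1)) (f : P ⟶ X) : f = 0 := by
  have := t.isLE_shift X (-1) (-1) 0
  rw [← cancel_mono (shiftNegOneShiftOne X).inv, zero_comp]
  exact hP.2 _ (t.le_of_isLE _ _) _

lemma isDerivedProjective.eq_zero_of_isGE {X : D} (hX : t.IsGE X 1) (f : P ⟶ X) : f = 0 := by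
  have : t.IsLE P 0 := ⟨hP.1⟩
  exact t.zero f 0 1

lemma isDerivedProjective.eq_zero_of_heart {X : D} (hX : t.heart X) {m : ℤ} (hm : m ≠ 0)
    (f : P ⟶ X⟦m⟧) : f = 0 := by
  obtain ⟨_, _⟩ := (t.mem_heart_iff X).1 hX
  rcases hm.lt_or_gt with hm | hm
  · have := t.isGE_shift X 0 m (-m)
    exact hP.eq_zero_of_isGE (t.isGE_of_ge _ 1 (-m)) f
  · have := t.isLE_shift X 0 m (-m)
    exact hP.eq_zero_of_isLE (t.isLE_of_le _ (-m) (-1)) f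

lemma isDerivedProjective.of_retract {Q : D} {i : Q ⟶ P} {r : P ⟶ Q} (hir : i ≫ r = 𝟙 Q) :
    isDerivedProjective t Q := by
  have h : ∀ {X : D} (f : Q ⟶ X), (∀ g : P ⟶ X, g = 0) → f = 0 := fun f hg ↦ by
    rw [← Category.id_comp f, ← hir, Category.assoc, hg (r ≫ f), comp_zero]
  refine ⟨t.le_iff_isLE _ _ |>.2 ?_, fun X hX f ↦ h f (hP.2 X hX)⟩
  rw [t.isLE_iff_orthogonal 0 1 (by simp)]
  exact fun Y f hY ↦ h f (hP.eq_zero_of_isGE hY)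

end DerivedProjective

variable {t} in
lemma isDerivedProjective.biprod {P Q : D} (hP : isDerivedProjective t P)
    (hQ : isDerivedProjective t Q) : isDerivedProjective t (P ⊞ Q) := by
  have : t.IsLE P 0 := ⟨hP.1⟩
  have : t.IsLE Q 0 := ⟨hQ.1⟩
  refine ⟨(isLE_biprod t 0 P Q).le, fun X hX f ↦ ?_⟩
  ext
  · rw [hP.2 X hX (biprod.inl ≫ f), comp_zero]
  · rw [hQ.2 X hX (biprod.inr ≫ f), comp_zero]

lemma isDerivedProjective_of_isZero {P : D} (hP : IsZero P) : isDerivedProjective t P :=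
  ⟨(t.isLE_of_isZero hP 0).le, fun _ _ _ ↦ hP.eq_of_src _ _⟩

/-! ### Comparing derived projectives with their `H0` -/

section Cohomology

variable [IsTriangulated D]

instance : (H0 t).Additive where
  map_add {_ _ f g} := ObjectProperty.hom_ext _ ((t.truncGELE 0 0).map_add (f := f) (g := g))

/-- The canonical morphism `τ_{≤ 0} X ⟶ X`. -/
noncomputable def truncLEZeroι (X : D) : (t.truncLE 0).obj X ⟶ X := (t.truncLEι 0).app X

/-- The canonical morphism `τ_{≤ 0} X ⟶ H⁰(X)`. -/
noncomputable def truncLEZeroToH0 (X : D) : (t.truncLE 0).obj X ⟶ ((H0 t).obj X).obj :=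
  (t.truncGEπ 0).app ((t.truncLE 0).obj X)

instance (X : D) [t.IsLE X 0] : IsIso (truncLEZeroι t X) :=
  (t.isLE_iff_isIso_truncLEι_app 0 X).1 inferInstance

/-- The canonical morphism `X ⟶ H⁰(X)` for `X` in `D^{≤ 0}`. -/
noncomputable def toH0 (X : D) [t.IsLE X 0] : X ⟶ ((H0 t).obj X).obj :=
  inv (truncLEZeroι t X) ≫ truncLEZeroToH0 t X

lemma exists_triangle_toH0 (X : D) [t.IsLE X 0] :
    ∃ (A : D) (_ : t.IsLE A (-1)) (i : A ⟶ X) (δ : ((H0 t).obj X).obj ⟶ A⟦(1 : ℤ)⟧),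
      Triangle.mk i (toH0 t X) δ ∈ distTriang D :=
  ⟨_, t.isLE_truncLT_obj ((t.truncLE 0).obj X) 0 (-1), _, _,
    distinguished_of_iso_obj₂ (asIso (truncLEZeroι t X))
      (t.triangleLTGE_distinguished 0 ((t.truncLE 0).obj X))⟩

variable {t}

lemma toH0_naturality {X Y : D} [t.IsLE X 0] [t.IsLE Y 0] (f : X ⟶ Y) :
    toH0 t X ≫ ((H0 t).map f).hom = f ≫ toH0 t Y := by
  have h₁ : truncLEZeroToH0 t X ≫ ((H0 t).map f).hom =
      (t.truncLE 0).map f ≫ truncLEZeroToH0 t Y :=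
    ((t.truncGEπ 0).naturality ((t.truncLE 0).map f)).symm
  have h₂ : (t.truncLE 0).map f ≫ truncLEZeroι t Y = truncLEZeroι t X ≫ f :=
    (t.truncLEι 0).naturality f
  rw [toH0, toH0, Category.assoc, h₁, IsIso.inv_comp_eq, ← Category.assoc, ← Category.assoc, ← h₂,
    Category.assoc, Category.assoc, IsIso.hom_inv_id_assoc]

lemma toH0_comp_injective {X Y : D} [t.IsLE X 0] [t.IsGE Y 0] {f g : ((H0 t).obj X).obj ⟶ Y}
    (h : toH0 t X ≫ f = toH0 t X ≫ g) : f = g := by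
  rw [toH0, Category.assoc, Category.assoc, cancel_epi] at h
  exact t.from_truncGE_obj_ext h

lemma exists_toH0_comp {X Y : D} [t.IsLE X 0] [t.IsGE Y 0] (f : X ⟶ Y) :
    ∃ g, toH0 t X ≫ g = f := by
  obtain ⟨g, hg⟩ : ∃ g, truncLEZeroToH0 t X ≫ g = truncLEZeroι t X ≫ f :=
    ⟨_, t.π_descTruncGE _ _⟩
  exact ⟨g, by rw [toH0, Category.assoc, hg, IsIso.inv_hom_id_assoc]⟩

/-- The obstruction to lifting lies in `Hom(P, A⟦1⟧)` with `A⟦1⟧` in `D^{≤ -2}`, hence vanishes. -/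
lemma exists_comp_toH0 {P Y : D} [t.IsLE Y 0] (hP : isDerivedProjective t P)
    (f : P ⟶ ((H0 t).obj Y).obj) : ∃ g : P ⟶ Y, g ≫ toH0 t Y = f := by
  obtain ⟨A, hA, i, δ, hT⟩ := exists_triangle_toH0 t Y
  have := t.isLE_shift A (-1) 1 (-2)
  obtain ⟨g, hg⟩ := Triangle.coyoneda_exact₃ _ hT f
    (hP.eq_zero_of_isLE (t.isLE_of_le (A⟦(1 : ℤ)⟧) (-2) (-1)) _)
  exact ⟨g, hg.symm⟩

instance isIso_toH0 (X : D) [t.IsLE X 0] [t.IsGE X 0] : IsIso (toH0 t X) := by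
  obtain ⟨g, hg⟩ := exists_toH0_comp (t := t) (𝟙 X)
  exact ⟨g, hg, toH0_comp_injective (by rw [← Category.assoc, hg]; simp)⟩

/-- Objects of the heart are isomorphic to their cohomology in degree `0`. -/
noncomputable def heartIsoH0 (L : HeartCat t) : L ≅ (H0 t).obj L.obj :=
  t.heart.isoMk (asIso (toH0 t L.obj))

lemma H0_map_injective_of_heart {X Y : D} [t.IsLE X 0] (hY : t.heart Y) {f g : X ⟶ Y}
    (h : (H0 t).map f = (H0 t).map g) : f = g := by
  obtain ⟨_, _⟩ := (t.mem_heart_iff Y).1 hY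
  rw [← cancel_mono (toH0 t Y), ← toH0_naturality, ← toH0_naturality, h]

lemma exists_H0_map_eq_of_heart {X Y : D} [t.IsLE X 0] (hY : t.heart Y)
    (f : (H0 t).obj X ⟶ (H0 t).obj Y) : ∃ g : X ⟶ Y, (H0 t).map g = f := by
  obtain ⟨_, _⟩ := (t.mem_heart_iff Y).1 hY
  refine ⟨toH0 t X ≫ f.hom ≫ inv (toH0 t Y), ObjectProperty.hom_ext _ (toH0_comp_injective ?_)⟩
  rw [toH0_naturality]
  simp

variable {P : D} (hP : isDerivedProjective t P)
include hP

lemma isDerivedProjective.H0_map_injective {Y : D} [t.IsLE Y 0] {f g : P ⟶ Y}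
    (h : (H0 t).map f = (H0 t).map g) : f = g := by
  have : t.IsLE P 0 := ⟨hP.1⟩
  obtain ⟨A, hA, i, δ, hT⟩ := exists_triangle_toH0 t Y
  rw [← sub_eq_zero]
  have h0 : (f - g) ≫ toH0 t Y = 0 := by
    rw [Preadditive.sub_comp, ← toH0_naturality, ← toH0_naturality, h, sub_self]
  obtain ⟨a, ha⟩ := Triangle.coyoneda_exact₂ _ hT (f - g) h0
  rw [ha, hP.eq_zero_of_isLE hA a]
  exact zero_comp

lemma isDerivedProjective.exists_H0_map_eq {Y : D} [t.IsLE Y 0]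
    (f : (H0 t).obj P ⟶ (H0 t).obj Y) : ∃ g : P ⟶ Y, (H0 t).map g = f := by
  have : t.IsLE P 0 := ⟨hP.1⟩
  obtain ⟨g, hg⟩ := exists_comp_toH0 hP (toH0 t P ≫ f.hom)
  exact ⟨g, ObjectProperty.hom_ext _ (toH0_comp_injective (by rw [toH0_naturality, hg]))⟩

/-- An epimorphism of the heart with kernel `K` comes from a triangle, so the lifting obstruction
lies in `Hom(P, K⟦1⟧) = 0`. -/
lemma isDerivedProjective.projective_H0 : Projective ((H0 t).obj P) where
  factors {E X} f e _ := by
    have : t.IsLE P 0 := ⟨hP.1⟩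
    obtain ⟨K, i, δ, hT⟩ := AbelianSubcategory.exists_distinguished_triangle_of_epi
      (ι := t.heart.ι) (heart_hom_shift_eq_zero t) (admissibleMorphism_heart t) e
    obtain ⟨g, hg⟩ := Triangle.coyoneda_exact₃ _ hT (toH0 t P ≫ f.hom)
      (hP.2 K.obj (t.le_of_isLE _ 0) _)
    obtain ⟨g', hg'⟩ := exists_toH0_comp (t := t) (Y := E.obj) g
    refine ⟨ObjectProperty.homMk g', ObjectProperty.hom_ext _ (toH0_comp_injective ?_)⟩
    refine (Category.assoc _ _ _).symm.trans ?_
    change (toH0 t P ≫ g') ≫ e.hom = _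
    rw [hg']
    exact hg.symm

lemma isDerivedProjective.isZero_of_isZero_H0 (h : IsZero ((H0 t).obj P)) : IsZero P := by
  have : t.IsLE P 0 := ⟨hP.1⟩
  rw [IsZero.iff_id_eq_zero]
  exact hP.H0_map_injective (h.eq_of_src _ _)

lemma isDerivedProjective.isIso_or_isIso_id_sub_of_isLocalRing (hloc : IsLocalRing (End P))
    (f : (H0 t).obj P ⟶ (H0 t).obj P) : IsIso f ∨ IsIso (𝟙 _ - f) := by
  have : t.IsLE P 0 := ⟨hP.1⟩
  obtain ⟨g, rfl⟩ := hP.exists_H0_map_eq f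
  rw [← (H0 t).map_id, ← (H0 t).map_sub]
  rcases (isLocalRing_end_iff.1 hloc).2 g with _ | _
  · exact Or.inl inferInstance
  · exact Or.inr inferInstance

end Cohomology

end

section

variable {D : Type*} [Category D] [Preadditive D] [HasZeroObject D] [HasShift D ℤ]
  [∀ n : ℤ, (shiftFunctor D n).Additive] [Pretriangulated D] {t : TStructure D}

/-! ### Derived projective covers of simple objects -/

section DerivedProjectiveCover

lemma isSimpleInHeart.heart {L : D} (h : isSimpleInHeart t L) : t.heart L := h.choose

lemma isSimpleInHeart.isLE {L : D} (h : isSimpleInHeart t L) : t.IsLE L 0 :=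
  ((t.mem_heart_iff L).1 h.heart).1

variable [IsTriangulated D]

lemma isSimpleInHeart.simple_H0 {L : D} (h : isSimpleInHeart t L) : Simple ((H0 t).obj L) := by
  obtain ⟨h, _⟩ := h
  exact Simple.of_iso (heartIsoH0 ⟨L, h⟩).symm

lemma isSimpleInHeart.not_isZero {L : D} (h : isSimpleInHeart t L) : ¬ IsZero L := fun hL ↦ by
  have := h.simple_H0
  exact Simple.not_isZero _ ((H0 t).map_isZero hL)

lemma isDerivedProjective.isDerivedProjectiveCover_of_ne_zero {P L : D}
    (hP : isDerivedProjective t P) (hloc : IsLocalRing (End P)) (hL : isSimpleInHeart t L)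
    {π : P ⟶ L} (hπ : π ≠ 0) : IsDerivedProjectiveCover t π := by
  have := hL.simple_H0
  have := hL.isLE
  have := hP.projective_H0
  exact ⟨hP, isProjectiveCover_of_ne_zero (hP.isIso_or_isIso_id_sub_of_isLocalRing hloc)
    fun h ↦ hπ (hP.H0_map_injective (by rw [h, Functor.map_zero]))⟩

lemma IsDerivedProjectiveCover.comp_iso {P X X' : D} {π : P ⟶ X}
    (hπ : IsDerivedProjectiveCover t π) (e : X ≅ X') :
    IsDerivedProjectiveCover t (π ≫ e.hom) := by
  refine ⟨hπ.1, ?_⟩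
  rw [Functor.map_comp]
  exact hπ.2.comp_iso ((H0 t).mapIso e)

section

variable {P L : D} {π : P ⟶ L} (hπ : IsDerivedProjectiveCover t π) (hL : isSimpleInHeart t L)
include hπ hL

lemma IsDerivedProjectiveCover.not_isZero : ¬ IsZero P := fun h ↦ by
  have := hL.simple_H0
  have := hπ.2.2.1
  exact Simple.not_isZero _ (IsZero.of_epi ((H0 t).map π) ((H0 t).map_isZero h))

lemma IsDerivedProjectiveCover.ne_zero : π ≠ 0 := fun h ↦ by
  have := hL.simple_H0
  have := hπ.2.2.1
  exact Simple.not_isZero _ (IsZero.of_epi_eq_zero ((H0 t).map π) (by rw [h, Functor.map_zero]))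

lemma IsDerivedProjectiveCover.exists_iso_of_ne_zero {L' : D} (hL' : isSimpleInHeart t L')
    {σ : P ⟶ L'} (hσ : σ ≠ 0) : ∃ e : L ≅ L', π ≫ e.hom = σ := by
  have := hL.simple_H0
  have := hL'.simple_H0
  have := hL.isLE
  have := hL'.isLE
  have : t.IsLE P 0 := ⟨hπ.1.1⟩
  obtain ⟨e, he⟩ := IsProjectiveCover.exists_iso_of_ne_zero hπ.2 (σ := (H0 t).map σ)
    fun h ↦ hσ (hπ.1.H0_map_injective (by rw [h, Functor.map_zero]))
  obtain ⟨a, ha⟩ := exists_H0_map_eq_of_heart hL'.heart e.hom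
  obtain ⟨b, hb⟩ := exists_H0_map_eq_of_heart hL.heart e.inv
  refine ⟨⟨a, b, H0_map_injective_of_heart (t := t) hL.heart ?_,
    H0_map_injective_of_heart (t := t) hL'.heart ?_⟩, H0_map_injective_of_heart hL'.heart ?_⟩
  · rw [Functor.map_comp, ha, hb, Iso.hom_inv_id, CategoryTheory.Functor.map_id]
  · rw [Functor.map_comp, ha, hb, Iso.inv_hom_id, CategoryTheory.Functor.map_id]
  · rw [Functor.map_comp, ha, he]

lemma IsDerivedProjectiveCover.epi_H0_map_of_ne_zero {Q : D} (g : Q ⟶ P)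
    (hg : (H0 t).map (g ≫ π) ≠ 0) : Epi ((H0 t).map g) := by
  have := hL.simple_H0
  refine hπ.2.2.2 _ ?_
  rw [← Functor.map_comp]
  exact epi_of_nonzero_to_simple hg

/-- If `P ≅ Y ⊞ Z`, then `π` is nonzero on one summand. By essentiality that inclusion is epi on
`H0`, so the projection to the other summand vanishes. -/
lemma IsDerivedProjectiveCover.indecomposable : Indecomposable P := by
  have : t.IsLE P 0 := ⟨hπ.1.1⟩
  refine ⟨hπ.not_isZero hL, fun Y Z e ↦ ?_⟩
  have hZ' : isDerivedProjective t Z :=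
    hπ.1.of_retract (i := biprod.inr ≫ e.inv) (r := e.hom ≫ biprod.snd) (by simp)
  have hY' : isDerivedProjective t Y :=
    hπ.1.of_retract (i := biprod.inl ≫ e.inv) (r := e.hom ≫ biprod.fst) (by simp)
  have : t.IsLE Y 0 := ⟨hY'.1⟩
  have : t.IsLE Z 0 := ⟨hZ'.1⟩
  by_cases hY : (H0 t).map ((biprod.inl ≫ e.inv) ≫ π) = 0
  · by_cases hZ : (H0 t).map ((biprod.inr ≫ e.inv) ≫ π) = 0
    · refine (hπ.ne_zero hL ?_).elim
      have := hL.isLE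
      have h₁ := hY'.H0_map_injective (hY.trans (Functor.map_zero _ _ _).symm)
      have h₂ := hZ'.H0_map_injective (hZ.trans (Functor.map_zero _ _ _).symm)
      rw [← cancel_epi e.inv, comp_zero]
      ext
      · rw [← Category.assoc, h₁, comp_zero]
      · rw [← Category.assoc, h₂, comp_zero]
    · left
      have := hπ.epi_H0_map_of_ne_zero hL _ hZ
      have h : e.hom ≫ biprod.fst = 0 := hπ.1.H0_map_injective (by
        rw [← cancel_epi ((H0 t).map (biprod.inr ≫ e.inv)), ← Functor.map_comp, ← Functor.map_comp]
        simp)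
      rw [IsZero.iff_id_eq_zero, ← biprod.inl_fst (Y := Z), ← e.inv_hom_id_assoc biprod.fst, h,
        comp_zero, comp_zero]
  · right
    have := hπ.epi_H0_map_of_ne_zero hL _ hY
    have h : e.hom ≫ biprod.snd = 0 := hπ.1.H0_map_injective (by
      rw [← cancel_epi ((H0 t).map (biprod.inl ≫ e.inv)), ← Functor.map_comp, ← Functor.map_comp]
      simp)
    rw [IsZero.iff_id_eq_zero, ← biprod.inr_snd (X := Y), ← e.inv_hom_id_assoc biprod.snd, h,
      comp_zero, comp_zero]

/-- A derived projective cover of a simple object is isomorphic to every indecomposable derived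
projective object with a nonzero morphism to it. -/
lemma IsDerivedProjectiveCover.iso_of_ne_zero {Q : D} (hQ : isIndecDerivedProjective t Q)
    {σ : Q ⟶ L} (hσ : σ ≠ 0) : Nonempty (P ≅ Q) := by
  have := hL.simple_H0
  have := hL.isLE
  have : t.IsLE P 0 := ⟨hπ.1.1⟩
  have : t.IsLE Q 0 := ⟨hQ.1.1⟩
  have : Epi ((H0 t).map σ) := epi_of_nonzero_to_simple
    fun h ↦ hσ (hQ.1.H0_map_injective (by rw [h, Functor.map_zero]))
  have := hQ.1.projective_H0
  obtain ⟨s, r, hsr, -⟩ := hπ.2.exists_section ((H0 t).map σ)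
  obtain ⟨s, rfl⟩ := hπ.1.exists_H0_map_eq s
  obtain ⟨r, rfl⟩ := hQ.1.exists_H0_map_eq r
  refine iso_of_indecomposable_of_retract hQ.2 (i := s) (r := r)
    (hπ.1.H0_map_injective ?_) (hπ.not_isZero hL)
  rw [Functor.map_comp, hsr, CategoryTheory.Functor.map_id]

end

lemma isDerivedProjective.exists_ne_zero_to_simple (hfl : IsFiniteLengthCategory (HeartCat t))
    {P : D} (hP : isDerivedProjective t P) (hP0 : ¬ IsZero P) :
    ∃ (L : D) (π : P ⟶ L), isSimpleInHeart t L ∧ π ≠ 0 := by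
  have : t.IsLE P 0 := ⟨hP.1⟩
  have := (hfl ((H0 t).obj P)).1
  obtain ⟨L, _, σ, _⟩ := exists_epi_to_simple fun h ↦ hP0 (hP.isZero_of_isZero_H0 h)
  refine ⟨L.obj, toH0 t P ≫ σ.hom, ⟨L.property, inferInstance⟩, fun h ↦ ?_⟩
  have hσ : σ = 0 := ObjectProperty.hom_ext _ (toH0_comp_injective (h.trans comp_zero.symm))
  exact Simple.not_isZero L (IsZero.of_epi_eq_zero σ hσ)

end DerivedProjectiveCover

/-! ### Recovering `t` from a detecting set -/

section Detection

/-- `S` detects nonzero objects of the heart. -/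
def DetectsHeart (t : TStructure D) (S : Set D) : Prop :=
  ∀ M : D, t.heart M → (∀ P ∈ S, ∀ f : P ⟶ M, f = 0) → IsZero M

variable [IsTriangulated D] {S : Set D} (hS : ∀ P ∈ S, isDerivedProjective t P)
  (hdet : DetectsHeart t S)
include hS hdet

/-- Here `τ_{≤ 0} Y` lies in the heart. A map from `P` to it dies in `Y`, so it factors through
`(τ_{≥ 1} Y)⟦-1⟧` in `D^{≥ 2}` and is zero. -/
lemma DetectsHeart.isGE_one {Y : D} [t.IsGE Y 0] (hY : ∀ P ∈ S, ∀ f : P ⟶ Y, f = 0) :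
    t.IsGE Y 1 := by
  rw [t.isGE_iff_isZero_truncLE_obj 0 1 (by simp)]
  refine hdet _ ((t.mem_heart_iff _).2 ⟨inferInstance, inferInstance⟩) fun P hP f ↦ ?_
  obtain ⟨g, hg⟩ := Triangle.coyoneda_exact₂ _
    (inv_rot_of_distTriang _ (t.triangleLEGE_distinguished 0 1 (by simp) Y)) f (hY P hP _)
  have : t.IsGE (((t.truncGE 1).obj Y)⟦(-1 : ℤ)⟧) 2 := t.isGE_shift _ 1 (-1) 2
  rw [hg, (hS P hP).eq_zero_of_isGE (t.isGE_of_ge (((t.truncGE 1).obj Y)⟦(-1 : ℤ)⟧) 1 2) g]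
  exact zero_comp

lemma DetectsHeart.isLE_neg_one {Y : D} [t.IsLE Y 0] (hY : ∀ P ∈ S, ∀ f : P ⟶ Y, f = 0) :
    t.IsLE Y (-1) := by
  have hz : IsZero ((H0 t).obj Y).obj := hdet _ ((H0 t).obj Y).property fun P hP f ↦ by
    obtain ⟨g, rfl⟩ := exists_comp_toH0 (hS P hP) f
    rw [hY P hP g, zero_comp]
  obtain ⟨A, hA, i, δ, hT⟩ := exists_triangle_toH0 t Y
  have : IsIso i := (Triangle.isZero₃_iff_isIso₁ _ hT).1 hz
  exact t.isLE_of_iso (asIso i) (-1)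

lemma DetectsHeart.isGE_succ {Y : D} {n : ℤ} [t.IsGE Y n]
    (hY : ∀ P ∈ S, ∀ f : P ⟶ Y⟦n⟧, f = 0) : t.IsGE Y (n + 1) := by
  have := t.isGE_shift Y n n 0
  have := hdet.isGE_one hS hY
  exact t.isGE_of_shift Y (n + 1) n 1

lemma DetectsHeart.isLE_pred {Y : D} {n : ℤ} [t.IsLE Y n]
    (hY : ∀ P ∈ S, ∀ f : P ⟶ Y⟦n⟧, f = 0) : t.IsLE Y (n - 1) := by
  have := t.isLE_shift Y n n 0
  have := hdet.isLE_neg_one hS hY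
  exact t.isLE_of_shift Y (n - 1) n (-1)

variable (ht : IsNondegenerate t)
include ht

/-- Each vanishing raises the lower bound by one, so `Y` lies in every `D^{≥ m}` and non-degeneracy
applies. -/
lemma DetectsHeart.isZero_of_isGE {Y : D} (n : ℤ) (hn : t.IsGE Y n)
    (hY : ∀ m : ℤ, ∀ P ∈ S, ∀ f : P ⟶ Y⟦m⟧, f = 0) : IsZero Y := by
  have h : ∀ k : ℕ, t.IsGE Y (n + k) := fun k ↦ by
    induction k with
    | zero => simpa using hn
    | succ k ih => simpa [add_assoc] using hdet.isGE_succ hS (hY (n + k))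
  refine ht.2 Y fun m ↦ ?_
  have := h (m - n).toNat
  exact (t.isGE_of_ge Y m (n + (m - n).toNat)).ge

lemma DetectsHeart.isZero_of_isLE {Y : D} (n : ℤ) (hn : t.IsLE Y n)
    (hY : ∀ m : ℤ, ∀ P ∈ S, ∀ f : P ⟶ Y⟦m⟧, f = 0) : IsZero Y := by
  have h : ∀ k : ℕ, t.IsLE Y (n - k) := fun k ↦ by
    induction k with
    | zero => simpa using hn
    | succ k ih => simpa [sub_sub] using hdet.isLE_pred hS (hY (n - k))
  refine ht.1 Y fun m ↦ ?_
  have := h (n - m).toNat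
  exact (t.isLE_of_le Y (n - (n - m).toNat) m).le

/-- A set of derived projective objects detecting nonzero objects of the heart of a
non-degenerate t-structure determines this t-structure. -/
lemma DetectsHeart.isAssociatedTStructure : IsAssociatedTStructure S t := by
  constructor
  · ext X
    refine ⟨fun hX P hP m hm f ↦ ?_, fun hX ↦ ?_⟩
    · have : t.IsLE X 0 := ⟨hX⟩
      have := t.isLE_shift X 0 m (-m)
      exact (hS P hP).eq_zero_of_isLE (t.isLE_of_le (X⟦m⟧) (-m) (-1)) f
    · rw [t.le_iff_isLE, t.isLE_iff_isZero_truncGE_obj 0 1 (by simp)]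
      -- For `m > 0`, maps from `P` to `(τ_{≥ 1} X)⟦m⟧` lift to `X⟦m⟧`, where they vanish by
      -- assumption; for `m ≤ 0` the target is in `D^{≥ 1}`.
      refine hdet.isZero_of_isGE hS ht 1 inferInstance fun m P hP f ↦ ?_
      by_cases hm : 0 < m
      · have h₁ := t.isLE_shift ((t.truncLE 0).obj X) 0 m (-m)
        have h₂ := t.isLE_shift (((t.truncLE 0).obj X)⟦m⟧) (-m) 1 (-m - 1)
        obtain ⟨g, hg⟩ := Triangle.coyoneda_exact₃ _
          (Triangle.shift_distinguished _ (t.triangleLEGE_distinguished 0 1 (by simp) X) m) f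
          ((hS P hP).eq_zero_of_isLE
            (t.isLE_of_le ((((t.truncLE 0).obj X)⟦m⟧)⟦(1 : ℤ)⟧) (-m - 1) (-1)) _)
        rw [hg, hX P hP m hm g]
        exact zero_comp
      · have := t.isGE_shift ((t.truncGE 1).obj X) 1 m (1 - m)
        exact (hS P hP).eq_zero_of_isGE (t.isGE_of_ge _ 1 (1 - m)) f
  · ext X
    refine ⟨fun hX P hP m hm f ↦ ?_, fun hX ↦ ?_⟩
    · have : t.IsGE X 0 := ⟨hX⟩
      have := t.isGE_shift X 0 m (-m)
      exact (hS P hP).eq_zero_of_isGE (t.isGE_of_ge (X⟦m⟧) 1 (-m)) f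
    · rw [t.ge_iff_isGE, t.isGE_iff_isZero_truncLE_obj (-1) 0 (by simp)]
      -- For `m < 0`, a map to `(τ_{≤ -1} X)⟦m⟧` dies in `X⟦m⟧`, so it comes from `(τ_{≥ 0} X)⟦m -
      -- 1⟧` in `D^{≥ 1}`; for `m ≥ 0` the target is in `D^{≤ -1}`.
      refine hdet.isZero_of_isLE hS ht (-1) inferInstance fun m P hP f ↦ ?_
      by_cases hm : m < 0
      · have h₁ := t.isGE_shift ((t.truncGE 0).obj X) 0 m (-m)
        have h₂ := t.isGE_shift (((t.truncGE 0).obj X)⟦m⟧) (-m) (-1) (1 - m)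
        obtain ⟨g, hg⟩ := Triangle.coyoneda_exact₂ _ (inv_rot_of_distTriang _
          (Triangle.shift_distinguished _ (t.triangleLEGE_distinguished (-1) 0 (by simp) X) m)) f
          (hX P hP m hm _)
        rw [hg, (hS P hP).eq_zero_of_isGE
          (t.isGE_of_ge ((((t.truncGE 0).obj X)⟦m⟧)⟦(-1 : ℤ)⟧) 1 (1 - m)) g]
        exact zero_comp
      · have := t.isLE_shift ((t.truncLE (-1)).obj X) (-1) m (-1 - m)
        exact (hS P hP).eq_zero_of_isLE (t.isLE_of_le _ (-1 - m) (-1)) f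

end Detection

/-! ### Consequences of `t = t_S` -/

section Silting

variable {S : Set D} (hS : IsAssociatedTStructure S t)
include hS

lemma IsAssociatedTStructure.isDerivedProjective {P : D} (hP : P ∈ S) :
    isDerivedProjective t P := by
  refine ⟨(t.le_iff_isLE _ _).2 ((t.isLE_iff_orthogonal 0 1 (by simp) P).2 fun Y f hY ↦ ?_),
    fun X hX f ↦ ?_⟩
  · have := t.isGE_shift Y 1 1 0
    have h := t.ge_of_isGE (Y⟦(1 : ℤ)⟧) 0
    rw [hS.2] at h
    let e : (Y⟦(1 : ℤ)⟧)⟦(-1 : ℤ)⟧ ≅ Y := (shiftFunctorCompIsoId D (1 : ℤ) (-1) (by simp)).app Y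
    rw [← cancel_mono e.inv, zero_comp]
    exact h P hP (-1) (by simp) _
  · rw [hS.1] at hX
    exact hX P hP 1 (by simp) f

/-- An undetected `M` receives no maps from `S` in any degree, so all its shifts lie in `S^{⊥_{>0}}
= D^{≤ 0}`; non-degeneracy then gives `M = 0`. -/
lemma IsAssociatedTStructure.detectsHeart (ht : IsNondegenerate t) : DetectsHeart t S := by
  intro M hM h
  have hall : ∀ m : ℤ, ∀ P ∈ S, ∀ f : P ⟶ M⟦m⟧, f = 0 := fun m P hP f ↦ by
    by_cases hm : m = 0
    · subst hm
      rw [← cancel_mono ((shiftFunctorZero D ℤ).app M).hom, zero_comp]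
      exact h P hP _
    · exact (hS.isDerivedProjective hP).eq_zero_of_heart hM hm f
  refine ht.1 M fun n ↦ ?_
  have hn : t.le 0 (M⟦n⟧) := by
    rw [hS.1]
    intro P hP m _ f
    rw [← cancel_mono ((shiftFunctorAdd D n m).app M).inv, zero_comp]
    exact hall _ P hP _
  have : t.IsLE (M⟦n⟧) 0 := ⟨hn⟩
  exact (t.isLE_of_shift M n n 0).le

variable [IsTriangulated D]

lemma IsAssociatedTStructure.exists_isDerivedProjectiveCover (hD : IsKrullSchmidt D)
    (ht : IsNondegenerate t) (hind : ∀ P ∈ S, Indecomposable P) {L : D}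
    (hL : isSimpleInHeart t L) :
    ∃ P ∈ S, ∃ π : P ⟶ L, IsDerivedProjectiveCover t π := by
  by_contra! h
  refine hL.not_isZero (hS.detectsHeart ht L hL.heart fun P hP f ↦ ?_)
  by_contra hf
  exact h P hP f ((hS.isDerivedProjective hP).isDerivedProjectiveCover_of_ne_zero
    (hD.isLocalRing_end (hind P hP)) hL hf)

/-- An indecomposable derived projective maps nontrivially to some simple, which has a cover in `S`;
uniqueness of covers identifies the two. -/
lemma IsAssociatedTStructure.isFullSetOfIsoReps (hD : IsKrullSchmidt D) (ht : IsNondegenerate t)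
    (hfl : IsFiniteLengthCategory (HeartCat t)) (hSilt : IsSiltingCollection S) :
    IsFullSetOfIsoReps (isIndecDerivedProjective t) S := by
  refine ⟨fun P hP ↦ ⟨hS.isDerivedProjective hP, hSilt.indecomposable P hP⟩, hSilt.eq_of_iso,
    fun Q hQ ↦ ?_⟩
  obtain ⟨L, σ, hL, hσ⟩ := hQ.1.exists_ne_zero_to_simple hfl hQ.2.1
  obtain ⟨P, hP, π, hπ⟩ :=
    hS.exists_isDerivedProjectiveCover hD ht hSilt.indecomposable hL
  obtain ⟨e⟩ := hπ.iso_of_ne_zero hL hQ hσ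
  exact ⟨P, hP, ⟨e.symm⟩⟩

end Silting

end

/-- `End L`-linear equivalences are `k`-linear. -/
lemma nonempty_linearEquiv_of_end {k : Type*} [Field k] {C : Type*} [Category C] [Preadditive C] [Linear k C]
    {P L : C}
    (e : (P ⟶ L) ≃ₗ[End L] End L) : Nonempty ((P ⟶ L) ≃ₗ[k] (L ⟶ L)) := by
  -- The scalar `r` acts as the endomorphism `r • 𝟙 L`.
  have hsmul : ∀ {Q : C} (r : k) (f : Q ⟶ L), r • f = (show End L from r • 𝟙 L) • f := fun r f ↦
    ((Linear.comp_smul _ _ _ f r (𝟙 L)).trans (by rw [Category.comp_id])).symm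
  exact ⟨{ e.toAddEquiv with
    map_smul' := fun r f ↦ by
      have h := e.map_smul (show End L from r • 𝟙 L) f
      rw [← hsmul] at h
      exact h.trans (hsmul r (e f : L ⟶ L)).symm }⟩

/-! ### Krull–Schmidt full subcategories -/

section FullSubcategory

variable {C : Type*} [Category C] [Preadditive C] (Q : ObjectProperty C)

lemma isLocalRing_end_fullSubcategory {X : Q.FullSubcategory} (h : IsLocalRing (End X.obj)) :
    IsLocalRing (End X) := by
  rw [isLocalRing_end_iff] at h ⊢
  refine ⟨fun hX ↦ h.1 (Q.ι.map_isZero hX), fun f ↦ ?_⟩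
  rcases h.2 f.hom with hf | hf
  · left
    have : IsIso (Q.ι.map f) := hf
    exact isIso_of_reflects_iso f Q.ι
  · right
    have : IsIso (Q.ι.map (𝟙 X - f)) := by
      rw [Q.ι.map_sub]
      exact hf
    exact isIso_of_reflects_iso (𝟙 X - f) Q.ι

/-- A full subcategory which contains the indecomposable summands of all its objects is
Krull--Schmidt if the ambient category is. -/
lemma IsKrullSchmidt.fullSubcategory (hC : IsKrullSchmidt C)
    (hQ : ∀ (X Y : C) (i : Y ⟶ X) (r : X ⟶ Y), Q X → i ≫ r = 𝟙 Y → IsLocalRing (End Y) → Q Y)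
    [Q.IsClosedUnderIsomorphisms] : IsKrullSchmidt Q.FullSubcategory := by
  rintro ⟨X, hX⟩
  obtain ⟨n, Y, b, ⟨hb⟩, ⟨e⟩, hY⟩ := hC X
  have hYQ : ∀ i, Q (Y i) := fun i ↦
    hQ X (Y i) (b.ι i ≫ e.hom) (e.inv ≫ b.π i) hX (by simp) (hY i)
  let b' : Bicone (fun i ↦ (⟨Y i, hYQ i⟩ : Q.FullSubcategory)) :=
    { pt := ⟨b.pt, Q.prop_of_iso e.symm hX⟩
      π := fun i ↦ ObjectProperty.homMk (b.π i)
      ι := fun i ↦ ObjectProperty.homMk (b.ι i)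
      ι_π := fun i j ↦ ObjectProperty.hom_ext _ (by
        refine (b.ι_π i j).trans ?_
        split_ifs with h
        · subst h; rfl
        · rfl) }
  refine ⟨n, _, b', ⟨isBilimitOfTotal b' (Q.ι.map_injective ?_)⟩, ⟨Q.isoMk e⟩,
    fun i ↦ isLocalRing_end_fullSubcategory Q (hY i)⟩
  rw [Q.ι.map_sum]
  exact IsBilimit.total hb

end FullSubcategory

section

variable {D : Type*} [Category D] [Preadditive D] [HasZeroObject D] [HasShift D ℤ]
  [∀ n : ℤ, (shiftFunctor D n).Additive] [Pretriangulated D] {t : TStructure D}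

lemma isDerivedProjective_biproduct {n : ℕ} {Y : Fin n → D}
    (hY : ∀ i, isDerivedProjective t (Y i)) : isDerivedProjective t (⨁ Y) := by
  refine ⟨(t.le_iff_isLE _ _).2 ((t.isLE_iff_orthogonal 0 1 (by simp) _).2 fun Z f hZ ↦ ?_),
    fun X hX f ↦ ?_⟩
  · ext i
    rw [(hY i).eq_zero_of_isGE hZ (biproduct.ι Y i ≫ f), comp_zero]
  · ext i
    rw [(hY i).2 X hX (biproduct.ι Y i ≫ f), comp_zero]

instance (S : Set D) : (kar S).IsClosedUnderIsomorphisms where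
  of_iso := fun e ⟨n, Y, Z, hY, ⟨e'⟩⟩ ↦ ⟨n, Y, Z, hY, ⟨biprod.mapIso e.symm (Iso.refl Z) ≪≫ e'⟩⟩

lemma kar_of_mem {S : Set D} {P : D} (hP : P ∈ S) : kar S P := by
  obtain ⟨Z, hZ⟩ := HasZeroObject.zero (C := D)
  exact ⟨1, fun _ ↦ P, Z, fun _ ↦ hP,
    ⟨⟨biprod.fst, biprod.inl, by ext <;> simp [hZ.eq_of_src biprod.inr 0], by simp⟩ ≪≫
      (biproductUniqueIso (fun _ : Fin 1 ↦ P)).symm⟩⟩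

lemma isKrullSchmidt_kar (hD : IsKrullSchmidt D) {S : Set D}
    (hS : IsFullSetOfIsoReps (isIndecDerivedProjective t) S) :
    IsKrullSchmidt (kar S).FullSubcategory := by
  refine IsKrullSchmidt.fullSubcategory (kar S) hD fun X Y i r ⟨n, P, Z, hP, ⟨e⟩⟩ hir hloc ↦ ?_
  have hY : isDerivedProjective t Y :=
    (isDerivedProjective_biproduct fun i ↦ (hS.1 _ (hP i)).1).of_retract
      (i := i ≫ biprod.inl ≫ e.hom) (r := e.inv ≫ biprod.fst ≫ r) (by simp [hir])
  obtain ⟨P', hP', ⟨e'⟩⟩ := hS.2.2 Y ⟨hY, indecomposable_of_isLocalRing hloc⟩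
  exact (kar S).prop_of_iso e'.symm (kar_of_mem hP')

variable [IsTriangulated D]

/-- Cover `M` by `H0 Q` with `Q` derived projective. The Krull–Schmidt summands of `Q` are
isomorphic to members of `S`, so `Hom(Q, M) = 0` and the epimorphism onto `M` is zero. -/
lemma HasEnoughDerivedProjectives.detectsHeart (h : HasEnoughDerivedProjectives t)
    (hD : IsKrullSchmidt D) {S : Set D}
    (hS : IsFullSetOfIsoReps (isIndecDerivedProjective t) S) : DetectsHeart t S := by
  intro M hM hzero
  obtain ⟨_, _⟩ := (t.mem_heart_iff M).1 hM
  have := h.2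
  let M' : HeartCat t := ⟨M, hM⟩
  obtain ⟨Q, hQ, ⟨e⟩⟩ := h.1 (Projective.over M') inferInstance
  have : t.IsLE Q 0 := ⟨hQ.1⟩
  have hall : ∀ f : Q ⟶ M, f = 0 := fun f ↦ by
    obtain ⟨n, Y, b, ⟨hb⟩, ⟨e'⟩, hY⟩ := hD Q
    rw [← cancel_epi e'.hom, ← cancel_epi (𝟙 b.pt), ← IsBilimit.total hb, comp_zero, comp_zero,
      Preadditive.sum_comp]
    refine Finset.sum_eq_zero fun i _ ↦ ?_
    have hYi : isDerivedProjective t (Y i) :=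
      hQ.of_retract (i := b.ι i ≫ e'.hom) (r := e'.inv ≫ b.π i) (by simp)
    obtain ⟨P, hP, ⟨c⟩⟩ := hS.2.2 _ ⟨hYi, indecomposable_of_isLocalRing (hY i)⟩
    have : b.ι i ≫ e'.hom ≫ f = 0 := by
      rw [← cancel_epi c.inv, comp_zero]
      exact hzero P hP _
    rw [Category.assoc, this, comp_zero]
  have hπ : e.hom ≫ Projective.π M' = 0 :=
    ObjectProperty.hom_ext _ (toH0_comp_injective (t := t) (Y := M)
      ((hall _).trans comp_zero.symm))
  exact (isZero_heart_iff t M').1 (IsZero.of_epi_eq_zero _ hπ)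

/-- The class of all `H0 Q` with `Q` derived projective is additive and contains covers of simples,
so finite length extends it to all projectives. -/
lemma hasEnoughDerivedProjectives_of_simple (hfl : IsFiniteLengthCategory (HeartCat t))
    (h : ∀ L : D, isSimpleInHeart t L →
      ∃ (P : D) (π : P ⟶ L), IsDerivedProjectiveCover t π) :
    HasEnoughDerivedProjectives t := by
  let C : ObjectProperty (HeartCat t) := fun M ↦
    ∃ Q : D, isDerivedProjective t Q ∧ Nonempty ((H0 t).obj Q ≅ M)
  have : C.IsClosedUnderIsomorphisms := ⟨fun e ⟨Q, hQ, ⟨e'⟩⟩ ↦ ⟨Q, hQ, ⟨e' ≪≫ e⟩⟩⟩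
  have hzero : ∃ Z, IsZero Z ∧ C Z := by
    obtain ⟨Z, hZ⟩ := HasZeroObject.zero (C := D)
    exact ⟨_, (H0 t).map_isZero hZ, Z, isDerivedProjective_of_isZero t hZ, ⟨Iso.refl _⟩⟩
  have hbiprod : ∀ X Y, C X → C Y → C (X ⊞ Y) := fun X Y ⟨P, hP, ⟨e⟩⟩ ⟨Q, hQ, ⟨e'⟩⟩ ↦ by
    have := preservesBinaryBiproducts_of_preservesBiproducts (H0 t)
    exact ⟨_, hP.biprod hQ, ⟨(H0 t).mapBiprod P Q ≪≫ biprod.mapIso e e'⟩⟩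
  have hproj : ∀ X, C X → Projective X := fun X ⟨P, hP, ⟨e⟩⟩ ↦
    Projective.of_iso e hP.projective_H0
  have hsimple : ∀ (L : HeartCat t) [Simple L],
      ∃ (X : HeartCat t) (π : X ⟶ L), C X ∧ IsProjectiveCover π := fun L _ ↦ by
    obtain ⟨P, π, hP, hπ⟩ := h L.obj ⟨L.property, inferInstance⟩
    exact ⟨_, _, ⟨P, hP, ⟨Iso.refl _⟩⟩, hπ.comp_iso (heartIsoH0 L).symm⟩
  refine ⟨fun P (_ : Projective P) ↦ of_projective_of_forall_simple hfl C hzero hbiprod hsimple P, ⟨fun X ↦ ?_⟩⟩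
  obtain ⟨P, π, hP, _⟩ := exists_epi_of_forall_simple hfl C hzero hbiprod hproj
    (fun L _ ↦ by
      obtain ⟨X, π, hX, hπ⟩ := hsimple L
      exact ⟨X, π, hX, hπ.2.1⟩) X
  exact ⟨{ p := P, projective := hproj P hP, f := π, epi := inferInstance }⟩

/-! ### The bijection with simples and the Hom-relations -/

section Bijection

variable {𝓛 𝓟 : Set D} (h𝓛 : IsFullSetOfIsoReps (isSimpleInHeart t) 𝓛)
  (h𝓟 : IsFullSetOfIsoReps (isIndecDerivedProjective t) 𝓟)
include h𝓛 h𝓟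

/-- Send `P` to a simple it covers. Uniqueness of covers gives injectivity; surjectivity holds
because a cover of a simple is indecomposable and has only one simple quotient. -/
lemma exists_equiv_isDerivedProjectiveCover (hD : IsKrullSchmidt D)
    (hfl : IsFiniteLengthCategory (HeartCat t))
    (h : ∀ L ∈ 𝓛, ∃ (P : D) (π : P ⟶ L), IsDerivedProjectiveCover t π) :
    ∃ φ : 𝓟 ≃ 𝓛, ∀ P : 𝓟, ∃ π : P.1 ⟶ (φ P).1, IsDerivedProjectiveCover t π := by
  have hex : ∀ P : 𝓟, ∃ (L : 𝓛) (π : P.1 ⟶ L.1), IsDerivedProjectiveCover t π := fun P ↦ by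
    have hP := h𝓟.1 P.1 P.2
    obtain ⟨L, π, hL, hπ⟩ := hP.1.exists_ne_zero_to_simple hfl hP.2.1
    obtain ⟨L', hL', ⟨e⟩⟩ := h𝓛.2.2 L hL
    exact ⟨⟨L', hL'⟩, π ≫ e.hom, hP.1.isDerivedProjectiveCover_of_ne_zero
      (hD.isLocalRing_end hP.2) (h𝓛.1 _ hL') fun h0 ↦ hπ (by
        rw [← cancel_mono e.hom, h0, zero_comp])⟩
  choose φ π hπ using hex
  refine ⟨Equiv.ofBijective φ ⟨fun P P' hPP' ↦ ?_, fun L ↦ ?_⟩, fun P ↦ ⟨π P, hπ P⟩⟩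
  · obtain ⟨σ, hσ⟩ : ∃ σ : P'.1 ⟶ (φ P).1, σ ≠ 0 := by
      rw [hPP']
      exact ⟨π P', (hπ P').ne_zero (h𝓛.1 _ (φ P').2)⟩
    exact Subtype.ext (h𝓟.2.1 _ P.2 _ P'.2
      ((hπ P).iso_of_ne_zero (h𝓛.1 _ (φ P).2) (h𝓟.1 _ P'.2) hσ))
  · have hL := h𝓛.1 _ L.2
    obtain ⟨P, σ, hσ⟩ := h L.1 L.2
    obtain ⟨P', hP', ⟨e⟩⟩ := h𝓟.2.2 P ⟨hσ.1, hσ.indecomposable hL⟩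
    obtain ⟨c, -⟩ := (hπ ⟨P', hP'⟩).exists_iso_of_ne_zero (h𝓛.1 _ (φ _).2) hL
      (σ := e.inv ≫ σ) fun h0 ↦ hσ.ne_zero hL (by rw [← cancel_epi e.inv, h0, comp_zero])
    exact ⟨⟨P', hP'⟩, Subtype.ext (h𝓛.2.1 _ (φ _).2 _ L.2 ⟨c⟩)⟩

end Bijection

/-- Precomposition with `π` is the isomorphism: any nonzero `σ : P ⟶ L` is `π` followed by an
automorphism of `L`. -/
lemma IsDerivedProjectiveCover.nonempty_linearEquiv {P L : D} {π : P ⟶ L}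
    (hπ : IsDerivedProjectiveCover t π) (hL : isSimpleInHeart t L) :
    Nonempty ((P ⟶ L) ≃ₗ[End L] End L) := by
  have := hπ.2.2.1
  have := hL.isLE
  let φ : End L →ₗ[End L] (P ⟶ L) :=
    { toFun := fun g ↦ π ≫ g
      map_add' := fun f g ↦ Preadditive.comp_add _ _ _ _ _ _
      map_smul' := fun f g ↦ (Category.assoc _ _ _).symm }
  refine ⟨(LinearEquiv.ofBijective φ ⟨?_, fun σ ↦ ?_⟩).symm⟩
  · rw [injective_iff_map_eq_zero]
    intro g hg
    refine H0_map_injective_of_heart (t := t) hL.heart ?_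
    have hg' : π ≫ g = 0 := hg
    rw [← cancel_epi ((H0 t).map π), ← Functor.map_comp, ← Functor.map_comp, hg', comp_zero]
  · by_cases hσ : σ = 0
    · exact ⟨0, by rw [map_zero, hσ]⟩
    · obtain ⟨e, he⟩ := hπ.exists_iso_of_ne_zero hL hL hσ
      exact ⟨e.hom, he⟩

lemma IsDerivedProjectiveCover.hom_shift_eq_zero {P L L' : D} {π : P ⟶ L}
    (hπ : IsDerivedProjectiveCover t π) (hL : isSimpleInHeart t L) (hL' : isSimpleInHeart t L')
    {m : ℤ} (h : m = 0 → IsEmpty (L ≅ L')) (f : P ⟶ L'⟦m⟧) : f = 0 := by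
  by_cases hm : m = 0
  · subst hm
    by_contra hf
    obtain ⟨e, -⟩ := hπ.exists_iso_of_ne_zero hL hL' (σ := f ≫ (shiftFunctorZero D ℤ).hom.app L')
      fun h0 ↦ hf (by rw [← cancel_mono ((shiftFunctorZero D ℤ).hom.app L'), h0, zero_comp])
    exact (h rfl).false e
  · exact hπ.1.eq_zero_of_heart hL'.heart hm f

end

end DerivedProj

theorem mainTheorem1 {k : Type*} [Field k]
    {D : Type*} [Category D] [Preadditive D] [Linear k D] [HasZeroObject D] [HasShift D ℤ]
    [∀ n : ℤ, (shiftFunctor D n).Additive] [∀ n : ℤ, (shiftFunctor D n).Linear k]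
    [Pretriangulated D] [IsTriangulated D]
    (hD : DerivedProj.IsKrullSchmidt D)
    (t : TStructure D) (ht : DerivedProj.IsNondegenerate t)
    (hfl : DerivedProj.IsFiniteLengthCategory (DerivedProj.HeartCat t))
    (𝓛 : Set D) (h𝓛 : DerivedProj.IsFullSetOfIsoReps (DerivedProj.isSimpleInHeart t) 𝓛)
    (𝓟 : Set D) (h𝓟 : DerivedProj.IsFullSetOfIsoReps (DerivedProj.isIndecDerivedProjective t) 𝓟) :
    List.TFAE [
      -- `t` is silting
      ∃ S : Set D, DerivedProj.IsSiltingCollection S ∧ DerivedProj.IsAssociatedTStructure S t,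
      -- `t` is silting, with silting collection `𝓟`
      DerivedProj.IsSiltingCollection 𝓟 ∧ DerivedProj.IsAssociatedTStructure 𝓟 t,
      -- the `Hom`-orthogonality relations, as left `End L`-modules
      ∃ φ : 𝓟 ≃ 𝓛,
        (∀ (P : 𝓟) (L : 𝓛), L = φ P → Nonempty ((P.1 ⟶ L.1) ≃ₗ[End L.1] End L.1)) ∧
        (∀ (P : 𝓟) (L : 𝓛) (m : ℤ), ¬(L = φ P ∧ m = 0) → ∀ f : P.1 ⟶ L.1⟦m⟧, f = 0),
      -- the `Hom`-orthogonality relations, as vector spaces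
      ∃ φ : 𝓟 ≃ 𝓛,
        (∀ (P : 𝓟) (L : 𝓛), L = φ P → Nonempty ((P.1 ⟶ L.1) ≃ₗ[k] (L.1 ⟶ L.1))) ∧
        (∀ (P : 𝓟) (L : 𝓛) (m : ℤ), ¬(L = φ P ∧ m = 0) → ∀ f : P.1 ⟶ L.1⟦m⟧, f = 0),
      -- every simple object has a derived projective cover
      ∀ L ∈ 𝓛, ∃ (P : D) (π : P ⟶ L), DerivedProj.IsDerivedProjectiveCover t π,
      -- `𝓟` is the set of derived projective covers of the simple objects
      ∃ φ : 𝓟 ≃ 𝓛, ∀ P : 𝓟, ∃ π : P.1 ⟶ (φ P).1, DerivedProj.IsDerivedProjectiveCover t π,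
      -- enough derived projectives
      DerivedProj.HasEnoughDerivedProjectives t] ∧
    -- every silting collection of `t` agrees with `𝓟` up to isomorphism
    ∀ S : Set D, DerivedProj.IsSiltingCollection S → DerivedProj.IsAssociatedTStructure S t →
      DerivedProj.IsFullSetOfIsoReps (DerivedProj.isIndecDerivedProjective t) S := by
  refine ⟨?_, fun S hS hSt ↦ hSt.isFullSetOfIsoReps hD ht hfl hS⟩
  tfae_have 2 → 1 := fun h ↦ ⟨𝓟, h⟩
  tfae_have 1 → 5 := fun ⟨S, hS, hSt⟩ L hL ↦ by
    obtain ⟨P, -, π, hπ⟩ :=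
      hSt.exists_isDerivedProjectiveCover hD ht hS.indecomposable (h𝓛.1 L hL)
    exact ⟨P, π, hπ⟩
  tfae_have 5 → 6 := DerivedProj.exists_equiv_isDerivedProjectiveCover h𝓛 h𝓟 hD hfl
  tfae_have 6 → 3 := fun ⟨φ, h⟩ ↦ by
    refine ⟨φ, fun P L hL ↦ ?_, fun P L m hm f ↦ ?_⟩
    · subst hL
      obtain ⟨π, hπ⟩ := h P
      exact hπ.nonempty_linearEquiv (h𝓛.1 _ (φ P).2)
    · obtain ⟨π, hπ⟩ := h P
      refine hπ.hom_shift_eq_zero (h𝓛.1 _ (φ P).2) (h𝓛.1 _ L.2) (fun h0 ↦ ⟨fun e ↦ hm ⟨?_, h0⟩⟩) f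
      exact Subtype.ext (h𝓛.2.1 _ L.2 _ (φ P).2 ⟨e.symm⟩)
  tfae_have 3 → 4 := fun ⟨φ, h₁, h₂⟩ ↦
    ⟨φ, fun P L hL ↦ (h₁ P L hL).elim DerivedProj.nonempty_linearEquiv_of_end, h₂⟩
  tfae_have 4 → 6 := fun ⟨φ, h₁, _⟩ ↦ by
    refine ⟨φ, fun P ↦ ?_⟩
    obtain ⟨e⟩ := h₁ P (φ P) rfl
    have hL := h𝓛.1 _ (φ P).2
    have hP := h𝓟.1 _ P.2
    -- The preimage of `𝟙` is nonzero since `φ P` is, and any nonzero map from `P` to a simple is a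
    -- cover.
    refine ⟨e.symm (𝟙 _), hP.1.isDerivedProjectiveCover_of_ne_zero (hD.isLocalRing_end hP.2) hL
      fun h0 ↦ hL.not_isZero ?_⟩
    rw [IsZero.iff_id_eq_zero]
    exact (LinearEquiv.map_eq_zero_iff e.symm).1 h0
  tfae_have 6 → 5 := fun ⟨φ, h⟩ L hL ↦ by
    obtain ⟨P, hP⟩ := φ.surjective ⟨L, hL⟩
    obtain ⟨π, hπ⟩ := h P
    exact ⟨P.1, _, hπ.comp_iso (eqToIso (congr_arg Subtype.val hP))⟩
  tfae_have 5 → 7 := fun h ↦ DerivedProj.hasEnoughDerivedProjectives_of_simple hfl fun L hL ↦ by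
    obtain ⟨L', hL', ⟨e⟩⟩ := h𝓛.2.2 L hL
    obtain ⟨P, π, hπ⟩ := h L' hL'
    exact ⟨P, _, hπ.comp_iso e.symm⟩
  tfae_have 7 → 2 := fun h ↦ by
    have hdet := DerivedProj.HasEnoughDerivedProjectives.detectsHeart h hD h𝓟
    have hass := hdet.isAssociatedTStructure (fun P hP ↦ (h𝓟.1 P hP).1) ht
    exact ⟨⟨DerivedProj.isKrullSchmidt_kar hD h𝓟, fun P hP ↦ (h𝓟.1 P hP).2, h𝓟.2.1, t, hass⟩,
      hass⟩
  tfae_finish
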